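/- Let $\mathcal G$ be a connected simple undirected graph with five vertices $v_1,\dots,v_5$, let $\mathcal L$ be its Laplacian and $\mathcal N_k$ the set of neighbours of $v_k$. Let $v_1$ be the single leader and $v_2,\dots,v_5$ the followers. Each follower moves according to $\dot x_i=\sum_{j:\,v_j\sim v_i}(x_j-x_i)$, where $x_1=z$ is the position of the leader, so that $\dot x=-\mathcal Fx-\mathcal Rz$, where $\mathcal F$ is $\mathcal L$ without the row and the column of $v_1$ and $\mathcal R$ is the column of $v_1$ in $\mathcal L$ without its entry at $v_1$. The system is controllable if for all $x^0,x^1\in\mathbb R^4$ there are $T>0$ and a continuous leader trajectory $z$ on $[0,T]$ that steers the followers from $x(0)=x^0$ to $x(T)=x^1$. Distinct nodes $v_p,v_q$ are DCD (double controllability destructive) nodes if every node other than $v_p,v_q$ is adjacent to both or to neither of them. Distinct followers $v_p,v_q,v_r$ are TCD (triple controllability destructive) nodes if every node other than these three is adjacent to all or to none of them and, among themselves, (I) all three are pairwise adjacent, or (II) one of them is adjacent to the other two, which are not adjacent to each other, or (III) exactly two of them are adjacent, the third being adjacent to neither, or (IV) no two of them are adjacent. Let $v_k$ be a vertex of $\mathcal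 G$. The other four vertices are QCD (quadruple controllability destructive) nodes if they can be named $s_1,s_2,t_1,t_2$ so that one of the following holds: (i) $v_k$ is adjacent to all four of them (and they induce any of the eleven graphs on four vertices up to isomorphism, i.e. an arbitrary graph); (ii) they induce the path $t_1\,s_1\,s_2\,t_2$, and $v_k$ is adjacent either exactly to the inner nodes $s_1,s_2$ or exactly to the end nodes $t_1,t_2$; (iii) they induce the 4-cycle $s_1\,s_2\,t_1\,t_2$, and $v_k$ is adjacent exactly to the two consecutive nodes $s_1,s_2$; (iv) they induce exactly the two disjoint edges $s_1t_2$ and $s_2t_1$, and $v_k$ is adjacent exactly to $s_1,s_2$. Theorem. The system is controllable if and only if the following three conditions hold simultaneously: (1) $v_2,v_3,v_4,v_5$ are not QCD nodes; (2) no three of $v_2,v_3,v_4,v_5$ are TCD nodes; (3) no two of $v_2,v_3,v_4,v_5$ are DCD nodes. -/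

import Mathlib

namespace MultiAgent

/-- Controllability of the linear control system `x' = A x + B u` with state in `ℝⁿ`: every initial
state can be steered to every final state in some finite time by a continuous input. -/
def LinearControllable {n m : Type*} [Fintype n] [Fintype m]
    (A : Matrix n n ℝ) (B : Matrix n m ℝ) : Prop :=
  ∀ x₀ x₁ : n → ℝ, ∃ T : ℝ, 0 < T ∧ ∃ (u : ℝ → m → ℝ) (x : ℝ → n → ℝ),
    ContinuousOn u (Set.Icc 0 T) ∧
    (∀ t ∈ Set.Icc (0 : ℝ) T,
      HasDerivWithinAt x (Matrix.mulVec A (x t) + Matrix.mulVec B (u t)) (Set.Icc 0 T) t) ∧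
    x 0 = x₀ ∧ x T = x₁

variable {V : Type*}

section Dynamics

variable [Fintype V] [DecidableEq V]

/-- The matrix `F`: the Laplacian with the rows and columns of the leaders deleted. -/
def followerMatrix (G : SimpleGraph V) [DecidableRel G.Adj] (L : Finset V) :
    Matrix {i // i ∉ L} {i // i ∉ L} ℝ :=
  (G.lapMatrix ℝ).submatrix (fun i => i.1) (fun i => i.1)

/-- The matrix `R`: the follower rows of the leader columns of the Laplacian. -/
def leaderMatrix (G : SimpleGraph V) [DecidableRel G.Adj] (L : Finset V) :
    Matrix {i // i ∉ L} {j // j ∈ L} ℝ :=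
  (G.lapMatrix ℝ).submatrix (fun i => i.1) (fun j => j.1)

/-- Controllability of the single-integrator multi-agent system on `G` with leader set `L`.
Under the neighbour-based rule the followers obey `x' = -F x - R z`, where the
control `z` is the position trajectory of the leaders. -/
def IsControllable (G : SimpleGraph V) [DecidableRel G.Adj] (L : Finset V) : Prop :=
  LinearControllable (-followerMatrix G L) (-leaderMatrix G L)

end Dynamics

/-- `v_p`, `v_q` are double controllability destructive (DCD) nodes: every other node is adjacent
to both of them or to neither of them. -/
def IsDCD (G : SimpleGraph V) (p q : V) : Prop :=
  p ≠ q ∧ ∀ k, k ≠ p → k ≠ q →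
    (p ∈ G.neighborSet k ∧ q ∈ G.neighborSet k) ∨ (p ∉ G.neighborSet k ∧ q ∉ G.neighborSet k)

/-- The followers adjacent to `k`, when `L` is the set of leaders. -/
def followerNeighbors (G : SimpleGraph V) (L : Finset V) (k : V) : Set V :=
  {i | G.Adj k i ∧ i ∉ L}

/-- The three nodes are pairwise adjacent. -/
def TopologyI (N : V → Set V) (p q r : V) : Prop :=
  (q ∈ N p ∧ r ∈ N p) ∧ (p ∈ N q ∧ r ∈ N q) ∧ (p ∈ N r ∧ q ∈ N r)

/-- `p` is adjacent to `q` and `r`, and each of `q`, `r` is adjacent only to `p`. -/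
def TopologyII (N : V → Set V) (p q r : V) : Prop :=
  (q ∈ N p ∧ r ∈ N p) ∧ (p ∈ N q ∧ r ∉ N q) ∧ (p ∈ N r ∧ q ∉ N r)

/-- Among `p, q, r`, the only neighbour of `p` is `q` and the only neighbour of `q` is `p`. -/
def TopologyIII (N : V → Set V) (p q r : V) : Prop :=
  (q ∈ N p ∧ r ∉ N p) ∧ (p ∈ N q ∧ r ∉ N q)

/-- The three nodes are pairwise nonadjacent. -/
def TopologyIV (N : V → Set V) (p q r : V) : Prop :=
  (q ∉ N p ∧ r ∉ N p) ∧ (p ∉ N q ∧ r ∉ N q) ∧ (p ∉ N r ∧ q ∉ N r)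

/-- `v_p`, `v_q`, `v_r` are triple controllability destructive (TCD) nodes. Topologies II and III
are allowed with any of the three nodes in the distinguished role. -/
def IsTCD (G : SimpleGraph V) (L : Finset V) (p q r : V) : Prop :=
  let N := followerNeighbors G L
  (p ≠ q ∧ p ≠ r ∧ q ≠ r) ∧
  (∀ k, k ≠ p → k ≠ q → k ≠ r →
    (p ∈ N k ∧ q ∈ N k ∧ r ∈ N k) ∨ (p ∉ N k ∧ q ∉ N k ∧ r ∉ N k)) ∧
  (TopologyI N p q r ∨
    (TopologyII N p q r ∨ TopologyII N q r p ∨ TopologyII N r p q) ∨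
    (TopologyIII N p q r ∨ TopologyIII N q r p ∨ TopologyIII N r p q) ∨
    TopologyIV N p q r)

/-- The four nodes of `Q` are quadruple controllability destructive (QCD) nodes of the five-vertex
graph `G`. With `Q = {s₁, s₂, t₁, t₂}` and `k` the fifth vertex, one of the following holds:
* `k` is adjacent to all of `Q`, and `Q` carries one of the eleven graphs on four vertices up to
  isomorphism (that is, any graph at all);
* `Q` carries the path `t₁ s₁ s₂ t₂`, and `k` is adjacent either exactly to its inner nodes
  `s₁, s₂` or exactly to its end nodes `t₁, t₂`;
* `Q` carries the 4-cycle `s₁ s₂ t₁ t₂`, and `k` is adjacent exactly to the consecutive nodes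
  `s₁, s₂`;
* `Q` carries the two disjoint edges `s₁ t₂` and `s₂ t₁`, and `k` is adjacent exactly to
  `s₁, s₂`. -/
def IsQCD [DecidableEq V] (G : SimpleGraph V) (Q : Finset V) : Prop :=
  ∃ k s₁ s₂ t₁ t₂ : V,
    [k, s₁, s₂, t₁, t₂].Nodup ∧ (∀ v, v ∈ [k, s₁, s₂, t₁, t₂]) ∧ Q = {s₁, s₂, t₁, t₂} ∧
    ((G.Adj k s₁ ∧ G.Adj k s₂ ∧ G.Adj k t₁ ∧ G.Adj k t₂) ∨
      G.edgeSet = {s(t₁, s₁), s(s₁, s₂), s(s₂, t₂), s(k, s₁), s(k, s₂)} ∨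
      G.edgeSet = {s(t₁, s₁), s(s₁, s₂), s(s₂, t₂), s(k, t₁), s(k, t₂)} ∨
      G.edgeSet = {s(s₁, s₂), s(s₂, t₁), s(t₁, t₂), s(t₂, s₁), s(k, s₁), s(k, s₂)} ∨
      G.edgeSet = {s(s₁, t₂), s(s₂, t₁), s(k, s₁), s(k, s₂)})

end MultiAgent

/-! By Kalman's criterion the system is controllable exactly when no proper subspace is invariant
under F and contains r = -R. For four followers this says that r, Fr, F²r, F³r span ℝ⁴.

Necessity exhibits proper invariant subspaces. A graph automorphism that fixes the leader and moves
a follower confines the reachable states to its fixed vectors (`not_isControllable_of_iso`). For DCD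
nodes it is their transposition; for the QCD shapes (ii)–(iv) it is the double swap s₁ ↔ s₂, t₁ ↔
t₂. In shape (i) r is the all-ones vector, an eigenvector of F (`not_isControllable_of_forall_adj`).
Three TCD nodes always contain a DCD pair (`IsTCD.exists_isDCD`), so condition (3) already implies
condition (2).

Sufficiency is a finite check. A graph on five labelled vertices is ten Booleans, and
`krylovDet_ne_zero_or_destructiveTest` verifies in all 1024 cases that a vanishing Krylov
determinant forces an isolated vertex, a DCD pair or QCD followers. Connectedness excludes the
first. -/

namespace MultiAgent

open Matrix NormedSpace

/-! ### Kalman's criterion via the controllability Gramian -/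

section Kalman

/-- The propagator `exp (-t A)` of the reversed uncontrolled system. -/
noncomputable def backwardFlow {n : Type*} [Fintype n] (A : Matrix n n ℝ) (t : ℝ) :
    (n → ℝ) →L[ℝ] (n → ℝ) :=
  exp (t • (-A.mulVecLin.toContinuousLinearMap))

variable {n m : Type*} [Fintype n] (A : Matrix n n ℝ) (B : Matrix n m ℝ)

theorem backwardFlow_zero : backwardFlow A 0 = 1 := by
  simp [backwardFlow]

theorem hasDerivAt_backwardFlow (t : ℝ) :
    HasDerivAt (backwardFlow A)
      (backwardFlow A t * (-A.mulVecLin.toContinuousLinearMap)) t :=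
  hasDerivAt_exp_smul_const (-A.mulVecLin.toContinuousLinearMap) t

theorem hasDerivAt_backwardFlow_apply (t : ℝ) (y : n → ℝ) :
    HasDerivAt (fun s => backwardFlow A s y) (backwardFlow A t (-(A *ᵥ y))) t := by
  simpa using (hasDerivAt_backwardFlow A t).clm_apply (hasDerivAt_const t y)

theorem hasDerivAt_backwardFlow_neg (t : ℝ) :
    HasDerivAt (fun s => backwardFlow A (-s))
      (A.mulVecLin.toContinuousLinearMap * backwardFlow A (-t)) t := by
  simpa [backwardFlow] using hasDerivAt_exp_smul_const' (A.mulVecLin.toContinuousLinearMap) t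

theorem continuous_backwardFlow : Continuous (backwardFlow A) :=
  continuous_iff_continuousAt.2 fun t => (hasDerivAt_backwardFlow A t).continuousAt

theorem backwardFlow_add (s t : ℝ) :
    backwardFlow A (s + t) = backwardFlow A s * backwardFlow A t := by
  let _ : NormedAlgebra ℚ ((n → ℝ) →L[ℝ] (n → ℝ)) := NormedAlgebra.restrictScalars ℚ ℝ _
  unfold backwardFlow
  rw [add_smul]
  exact NormedSpace.exp_add_of_commute (((Commute.refl _).smul_left s).smul_right t)

theorem backwardFlow_neg_apply (t : ℝ) (y : n → ℝ) :
    backwardFlow A t (backwardFlow A (-t) y) = y := by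
  have h := backwardFlow_add A t (-t)
  rw [add_neg_cancel, backwardFlow_zero] at h
  exact (congrArg (fun f => f y) h).symm

theorem backwardFlow_neg_apply' (t : ℝ) (y : n → ℝ) :
    backwardFlow A (-t) (backwardFlow A t y) = y := by
  simpa using backwardFlow_neg_apply A (-t) y

/-- An invariant subspace is invariant under the propagator. -/
theorem backwardFlow_mem {S : Submodule ℝ (n → ℝ)} (hA : ∀ y ∈ S, A *ᵥ y ∈ S) (t : ℝ)
    {y : n → ℝ} (hy : y ∈ S) : backwardFlow A t y ∈ S := by
  set M : (n → ℝ) →L[ℝ] (n → ℝ) := t • (-A.mulVecLin.toContinuousLinearMap) with hM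
  have hpow : ∀ k : ℕ, (M ^ k) y ∈ S := by
    intro k
    induction k with
    | zero => simpa using hy
    | succ k ih =>
      rw [pow_succ']
      have : (M * M ^ k) y = t • (-(A *ᵥ ((M ^ k) y))) := by simp [hM]
      rw [this]
      exact S.smul_mem _ (S.neg_mem (hA _ ih))
  have hs := (exp_series_hasSum_exp' (𝕂 := ℝ) M).mapL
    (ContinuousLinearMap.apply ℝ (n → ℝ) y)
  -- The partial sums of the exponential series stay in S, which is closed because it is
  -- finite-dimensional.
  refine S.closed_of_finiteDimensional.mem_of_tendsto hs (Filter.Eventually.of_forall fun F => ?_)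
  refine S.sum_mem fun k _ => ?_
  simpa using S.smul_mem _ (hpow k)

/-- The input obtained by pairing `η` with the backward flow of the columns of `B`. -/
noncomputable def gramianInput (s : ℝ) : (n → ℝ) →ₗ[ℝ] (m → ℝ) where
  toFun η j := η ⬝ᵥ backwardFlow A s (B.col j)
  map_add' η θ := by ext j; simp [add_dotProduct]
  map_smul' c η := by ext j; simp [smul_dotProduct]

theorem continuous_gramianInput (η : n → ℝ) : Continuous fun s => gramianInput A B s η := by
  refine continuous_pi fun j => ?_
  have := (continuous_backwardFlow A).clm_apply (continuous_const (y := B.col j))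
  exact continuous_const.dotProduct this

variable [Fintype m]

/-- If the system is controllable, no proper invariant subspace contains the range of `B`. -/
theorem eq_top_of_linearControllable (h : LinearControllable A B) (S : Submodule ℝ (n → ℝ))
    (hA : ∀ y ∈ S, A *ᵥ y ∈ S) (hB : ∀ v, B *ᵥ v ∈ S) : S = ⊤ := by
  by_contra hS
  obtain ⟨y, hy⟩ : ∃ y, y ∉ S := by
    by_contra! hc
    exact hS (eq_top_iff.2 fun y _ => hc y)
  obtain ⟨T, hT, u, x, -, hx, hx0, hxT⟩ := h 0 y
  have hyT : backwardFlow A T y ∉ S := fun hm => hy <| by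
    simpa [backwardFlow_neg_apply'] using backwardFlow_mem A hA (-T) hm
  -- φ vanishes on S but not at e^{-TA}y. Along the trajectory φ(e^{-tA}x(t)) is constant: the drift
  -- cancels in the product rule, and the input term lies in S. Since it starts at 0, this is a
  -- contradiction.
  obtain ⟨φ, hφ, hSφ⟩ := S.exists_le_ker_of_notMem hyT
  refine hφ ?_
  have hd : ∀ t ∈ Set.Icc (0 : ℝ) T,
      HasDerivWithinAt (fun s => φ (backwardFlow A s (x s))) 0 (Set.Icc 0 T) t := by
    intro t ht
    have h1 := (hasDerivAt_backwardFlow A t).hasDerivWithinAt.clm_apply (hx t ht)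
    have h2 := φ.toContinuousLinearMap.hasFDerivAt.comp_hasDerivWithinAt t h1
    have h3 : φ (backwardFlow A t (B *ᵥ u t)) = 0 := hSφ (backwardFlow_mem A hA t (hB _))
    refine h2.congr_deriv ?_
    simpa using h3
  have hc := constant_of_derivWithin_zero (fun t ht => (hd t ht).differentiableWithinAt)
    (fun t ht => (hd t (Set.Ico_subset_Icc_self ht)).derivWithin
      (uniqueDiffOn_Icc hT t (Set.Ico_subset_Icc_self ht))) T (Set.right_mem_Icc.2 hT.le)
  simpa [hx0, hxT] using hc

theorem continuous_backwardFlow_gramianInput (η : n → ℝ) :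
    Continuous fun s => backwardFlow A s (B *ᵥ gramianInput A B s η) :=
  (continuous_backwardFlow A).clm_apply
    (continuous_const.matrix_mulVec (continuous_gramianInput A B η))

/-- `gramianInput` is the transpose of e^{-sA}B. This adjointness makes the quadratic form of the
Gramian an integral of squares. -/
theorem dotProduct_backwardFlow_mulVec (η : n → ℝ) (s : ℝ) (v : m → ℝ) :
    η ⬝ᵥ backwardFlow A s (B *ᵥ v) = gramianInput A B s η ⬝ᵥ v := by
  have : B *ᵥ v = ∑ j, v j • B.col j := by
    ext i; simp [mulVec, dotProduct, mul_comm]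
  rw [this, map_sum, dotProduct_sum]
  simp only [map_smul, dotProduct_smul]
  simp [gramianInput, dotProduct, mul_comm]

/-- The controllability Gramian on the time interval `[0, 1]`. -/
noncomputable def gramian : (n → ℝ) →ₗ[ℝ] (n → ℝ) where
  toFun η := ∫ s in (0 : ℝ)..1, backwardFlow A s (B *ᵥ gramianInput A B s η)
  map_add' η θ := by
    rw [← intervalIntegral.integral_add
      ((continuous_backwardFlow_gramianInput A B η).intervalIntegrable _ _)
      ((continuous_backwardFlow_gramianInput A B θ).intervalIntegrable _ _)]
    simp [mulVec_add]
  map_smul' c η := by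
    rw [RingHom.id_apply, ← intervalIntegral.integral_smul]
    simp [mulVec_smul]

theorem dotProduct_gramian (η : n → ℝ) :
    η ⬝ᵥ gramian A B η =
      ∫ s in (0 : ℝ)..1, gramianInput A B s η ⬝ᵥ gramianInput A B s η := by
  have h := (dotProductBilin ℝ ℝ η).toContinuousLinearMap.intervalIntegral_comp_comm
    ((continuous_backwardFlow_gramianInput A B η).intervalIntegrable
      (μ := MeasureTheory.volume) 0 1)
  simp only [← dotProduct_backwardFlow_mulVec]
  exact h.symm

/-- If only the whole space is an invariant subspace containing the range of `B`, then the
Gramian is injective. -/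
theorem gramian_injective
    (h : ∀ S : Submodule ℝ (n → ℝ), (∀ y ∈ S, A *ᵥ y ∈ S) → (∀ v, B *ᵥ v ∈ S) → S = ⊤) :
    Function.Injective (gramian A B) := by
  rw [injective_iff_map_eq_zero]
  intro η hη
  -- A continuous nonnegative integrand with zero integral vanishes identically.
  have hzero : ∀ s ∈ Set.Icc (0 : ℝ) 1, gramianInput A B s η = 0 := by
    by_contra! hc
    obtain ⟨s, hs, hne⟩ := hc
    have hpos := intervalIntegral.integral_pos (zero_lt_one' ℝ)
      ((continuous_gramianInput A B η).dotProduct (continuous_gramianInput A B η)).continuousOn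
      (fun _ _ => Finset.sum_nonneg fun _ _ => mul_self_nonneg _)
      ⟨s, hs, (Finset.sum_nonneg fun _ _ => mul_self_nonneg _).lt_of_ne'
        (mt dotProduct_self_eq_zero.1 hne)⟩
    rw [← dotProduct_gramian, hη, dotProduct_zero] at hpos
    exact hpos.false
  -- S consists of the y with η ⬝ᵥ e^{-sA}y = 0 throughout the open interval. Differentiating this
  -- identity in s shows that S is invariant under A.
  let S : Submodule ℝ (n → ℝ) :=
    ⨅ s ∈ Set.Ioo (0 : ℝ) 1, LinearMap.ker
      ((dotProductBilin ℝ ℝ η).comp (backwardFlow A s).toLinearMap)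
  have hS : ∀ y, y ∈ S ↔ ∀ s ∈ Set.Ioo (0 : ℝ) 1, η ⬝ᵥ backwardFlow A s y = 0 := by
    intro y
    simp [S, Submodule.mem_iInf]
  have htop : S = ⊤ := by
    refine h S (fun y hy => ?_) fun v => ?_
    · rw [hS] at hy ⊢
      intro s hs
      have h1 := (dotProductBilin ℝ ℝ η).toContinuousLinearMap.hasFDerivAt.comp_hasDerivAt s
        (hasDerivAt_backwardFlow_apply A s y)
      have h2 : HasDerivAt (fun t => η ⬝ᵥ backwardFlow A t y) 0 s :=
        (hasDerivAt_const s (0 : ℝ)).congr_of_eventuallyEq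
          (Filter.eventually_of_mem (Ioo_mem_nhds hs.1 hs.2) hy)
      have h3 : η ⬝ᵥ backwardFlow A s (-(A *ᵥ y)) = 0 := h1.unique h2
      simpa using h3
    · rw [hS]
      intro s hs
      rw [dotProduct_backwardFlow_mulVec, hzero s (Set.Ioo_subset_Icc_self hs), zero_dotProduct]
  -- Pairing e^{A/2}η at the interior time s = 1/2 gives η ⬝ᵥ η = 0.
  have hmem : backwardFlow A (-(1 / 2)) η ∈ S := htop ▸ Submodule.mem_top
  have h4 := (hS _).1 hmem (1 / 2) ⟨by norm_num, by norm_num⟩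
  rw [backwardFlow_neg_apply] at h4
  exact dotProduct_self_eq_zero.1 h4

/-- Kalman's criterion: if only the whole space is an invariant subspace containing the range of
`B`, then the system is controllable. -/
theorem linearControllable_of_forall_eq_top
    (h : ∀ S : Submodule ℝ (n → ℝ), (∀ y ∈ S, A *ᵥ y ∈ S) → (∀ v, B *ᵥ v ∈ S) → S = ⊤) :
    LinearControllable A B := by
  intro x₀ x₁
  obtain ⟨η, hη⟩ := LinearMap.injective_iff_surjective.1 (gramian_injective A B h)
    (backwardFlow A 1 x₁ - x₀)
  -- Variation of constants: the trajectory is e^{tA}(x₀ + ∫₀ᵗ e^{-sA}Bu(s) ds), and η was chosen so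
  -- that the bracket equals e^{-A}x₁ at t = 1.
  refine ⟨1, one_pos, fun s => gramianInput A B s η, fun t => backwardFlow A (-t)
    (x₀ + ∫ s in (0 : ℝ)..t, backwardFlow A s (B *ᵥ gramianInput A B s η)),
    (continuous_gramianInput A B η).continuousOn, fun t _ => ?_, ?_, ?_⟩
  · have h1 := ((continuous_backwardFlow_gramianInput A B η).integral_hasStrictDerivAt 0 t).hasDerivAt
    have h2 := (hasDerivAt_backwardFlow_neg A t).clm_apply (h1.const_add x₀)
    rw [backwardFlow_neg_apply'] at h2
    exact h2.hasDerivWithinAt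
  · simp [backwardFlow_zero]
  · change backwardFlow A (-1) (x₀ + gramian A B η) = x₁
    rw [hη, add_sub_cancel, backwardFlow_neg_apply']

end Kalman

variable {V : Type*}

/-! ### TCD nodes contain DCD nodes -/

section Destructive

variable {G : SimpleGraph V}

theorem isDCD_iff {p q : V} :
    IsDCD G p q ↔ p ≠ q ∧ ∀ k, k ≠ p → k ≠ q → (G.Adj k p ↔ G.Adj k q) := by
  simp only [IsDCD, SimpleGraph.mem_neighborSet, iff_iff_and_or_not_and_not]

/-- Among three TCD followers there are two DCD followers. -/
theorem IsTCD.exists_isDCD {L : Finset V} {p q r : V} (h : IsTCD G L p q r) (hp : p ∉ L) (hq : q ∉ L)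
    (hr : r ∉ L) : IsDCD G p q ∨ IsDCD G p r ∨ IsDCD G q r := by
  obtain ⟨⟨hpq, hpr, hqr⟩, h, -⟩ := h
  have h' : ∀ k, k ≠ p → k ≠ q → k ≠ r → (G.Adj k p ↔ G.Adj k q) ∧ (G.Adj k p ↔ G.Adj k r) := by
    intro k hkp hkq hkr
    rcases h k hkp hkq hkr with ⟨h1, h2, h3⟩ | ⟨h1, h2, h3⟩
    · exact ⟨iff_of_true h1.1 h2.1, iff_of_true h1.1 h3.1⟩
    · simp only [followerNeighbors, Set.mem_ofPred_eq, hp, hq, hr,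
        not_false_eq_true, and_true] at h1 h2 h3
      exact ⟨iff_of_false h1 h2, iff_of_false h1 h3⟩
  -- Pigeonhole: of the three pairs pq, pr, qr, two are both edges or both non-edges. The two
  -- endpoints they do not share are then DCD.
  simp only [isDCD_iff]
  by_cases h1 : G.Adj p q ↔ G.Adj p r
  · refine .inr (.inr ⟨hqr, fun k hkq hkr => ?_⟩)
    rcases eq_or_ne k p with rfl | hkp
    · exact h1
    · exact (h' k hkp hkq hkr).1.symm.trans (h' k hkp hkq hkr).2
  by_cases h2 : G.Adj q p ↔ G.Adj q r
  · refine .inr (.inl ⟨hpr, fun k hkp hkr => ?_⟩)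
    rcases eq_or_ne k q with rfl | hkq
    · exact h2
    · exact (h' k hkp hkq hkr).2
  refine .inl ⟨hpq, fun k hkp hkq => ?_⟩
  rcases eq_or_ne k r with rfl | hkr
  · rw [G.adj_comm k p, G.adj_comm k q]
    rw [G.adj_comm q p] at h2
    tauto
  · exact (h' k hkp hkq hkr).1

end Destructive

/-! ### Necessity: symmetry and the all-ones eigenvector -/

section Followers

variable [DecidableEq V] (v₁ : V)

/-- Extension of a vector of follower positions by the leader position `0`. -/
def extendZero : ({i // i ∉ ({v₁} : Finset V)} → ℝ) →ₗ[ℝ] (V → ℝ) where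
  toFun x k := if h : k ∉ ({v₁} : Finset V) then x ⟨k, h⟩ else 0
  map_add' x y := by ext k; by_cases h : k = v₁ <;> simp [h]
  map_smul' c x := by ext k; by_cases h : k = v₁ <;> simp [h]

variable {v₁}

@[simp]
theorem extendZero_leader (x : {i // i ∉ ({v₁} : Finset V)} → ℝ) : extendZero v₁ x v₁ = 0 := by
  simp [extendZero]

@[simp]
theorem extendZero_coe (x : {i // i ∉ ({v₁} : Finset V)} → ℝ) (i : {i // i ∉ ({v₁} : Finset V)}) :
    extendZero v₁ x i.1 = x i := by
  have h : i.1 ∉ ({v₁} : Finset V) := i.2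
  simp only [extendZero, LinearMap.coe_mk, AddHom.coe_mk, dif_pos h]

variable [Fintype V] (G : SimpleGraph V) [DecidableRel G.Adj]

/-- With the leader placed at 0, F is the full Laplacian read on the follower rows. Summing over all
of V allows reindexing by automorphisms and labellings. -/
theorem followerMatrix_mulVec (x : {i // i ∉ ({v₁} : Finset V)} → ℝ)
    (i : {i // i ∉ ({v₁} : Finset V)}) :
    (followerMatrix G {v₁} *ᵥ x) i =
      ∑ k, if G.Adj i.1 k then x i - extendZero v₁ x k else 0 := by
  have h1 : (followerMatrix G {v₁} *ᵥ x) i = (G.lapMatrix ℝ *ᵥ extendZero v₁ x) i.1 := by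
    simp only [mulVec, dotProduct, followerMatrix, submatrix_apply]
    rw [← Fintype.sum_subtype_add_sum_subtype (· ∉ ({v₁} : Finset V))
      (fun k => G.lapMatrix ℝ i.1 k * extendZero v₁ x k)]
    simp only [extendZero_coe]
    rw [left_eq_add]
    refine Finset.sum_eq_zero fun k _ => ?_
    have : k.1 = v₁ := by simpa using k.2
    simp [this]
  rw [h1, SimpleGraph.lapMatrix_mulVec_apply, ← Finset.sum_filter, Finset.sum_sub_distrib,
    Finset.sum_const, extendZero_coe, ← SimpleGraph.neighborFinset_eq_filter, nsmul_eq_mul,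
    SimpleGraph.card_neighborFinset_eq_degree]

theorem leaderMatrix_mulVec (u : {j // j ∈ ({v₁} : Finset V)} → ℝ)
    (i : {i // i ∉ ({v₁} : Finset V)}) :
    (-leaderMatrix G {v₁} *ᵥ u) i =
      if G.Adj i.1 v₁ then u ⟨v₁, Finset.mem_singleton_self v₁⟩ else 0 := by
  have hi : i.1 ≠ v₁ := by simpa using i.2
  have h : (-leaderMatrix G {v₁}) i ⟨v₁, Finset.mem_singleton_self v₁⟩ =
      if G.Adj i.1 v₁ then 1 else 0 := by
    simp [leaderMatrix, SimpleGraph.lapMatrix, SimpleGraph.degMatrix, hi,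
      SimpleGraph.adjMatrix_apply]
  have : ∀ j : {j // j ∈ ({v₁} : Finset V)}, j = ⟨v₁, Finset.mem_singleton_self v₁⟩ :=
    fun j => Subtype.ext (Finset.mem_singleton.1 j.2)
  rw [mulVec, dotProduct, Fintype.sum_eq_single ⟨v₁, Finset.mem_singleton_self v₁⟩
    fun j hj => (hj (this j)).elim, h]
  simp

/-- A nontrivial automorphism of the graph that fixes the leader destroys controllability. -/
theorem not_isControllable_of_iso (σ : G ≃g G) (hσ : σ v₁ = v₁) {p : V} (hp : σ p ≠ p) :
    ¬ IsControllable G {v₁} := by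
  intro h
  -- The σ-invariant follower states. The indicator of p lies outside S because σ moves p.
  let S : Submodule ℝ ({i // i ∉ ({v₁} : Finset V)} → ℝ) :=
    LinearMap.eqLocus (extendZero v₁)
      ((LinearMap.funLeft ℝ ℝ (σ : V → V)).comp (extendZero v₁))
  have hS : ∀ x, x ∈ S ↔ ∀ i, extendZero v₁ x i = extendZero v₁ x (σ i) := fun x => by
    simp [S, funext_iff, LinearMap.funLeft_apply]
  have hmem : ∀ i, i ∉ ({v₁} : Finset V) → σ i ∉ ({v₁} : Finset V) := by
    intro i hi
    rw [Finset.mem_singleton] at hi ⊢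
    exact fun hc => hi (σ.injective (hc.trans hσ.symm))
  have hS' : ∀ x, (∀ i (hi : i ∉ ({v₁} : Finset V)), x ⟨i, hi⟩ = x ⟨σ i, hmem i hi⟩) → x ∈ S := by
    intro x hx
    rw [hS]
    intro i
    by_cases hi : i ∈ ({v₁} : Finset V)
    · rw [Finset.mem_singleton.1 hi, hσ]
    · simpa [← extendZero_coe] using hx i hi
  have htop := eq_top_of_linearControllable _ _ h S
    (fun x hx => hS' _ fun i hi => ?_) (fun u => hS' _ fun i hi => ?_)
  · have hp₁ : p ∉ ({v₁} : Finset V) := by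
      rw [Finset.mem_singleton]
      rintro rfl
      exact hp hσ
    have h1 : Pi.single ⟨p, hp₁⟩ 1 ∈ S := htop ▸ Submodule.mem_top
    have h2 := (hS _).1 h1 p
    have h3 := extendZero_coe (v₁ := v₁) (Pi.single ⟨p, hp₁⟩ 1) ⟨p, hp₁⟩
    have h4 := extendZero_coe (v₁ := v₁) (Pi.single ⟨p, hp₁⟩ 1) ⟨σ p, hmem p hp₁⟩
    simp only at h3 h4
    rw [h3, h4] at h2
    simp [hp] at h2
  · rw [hS] at hx
    rw [neg_mulVec, Pi.neg_apply, Pi.neg_apply, followerMatrix_mulVec, followerMatrix_mulVec,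
      ← Equiv.sum_comp σ.toEquiv (fun k => if G.Adj (σ i) k then _ else _)]
    have := hx i
    have h3 := extendZero_coe x ⟨i, hi⟩
    have h4 := extendZero_coe x ⟨σ i, hmem i hi⟩
    simp only at h3 h4
    rw [h3, h4] at this
    refine congrArg Neg.neg (Finset.sum_congr rfl fun k _ => ?_)
    have hk : G.Adj (σ i) (σ.toEquiv k) ↔ G.Adj i k := σ.map_adj_iff
    rw [this]
    simp only [hk]
    rw [hx k]
    rfl
  · rw [leaderMatrix_mulVec, leaderMatrix_mulVec]
    simp only
    congr 1
    conv_rhs => rw [← hσ]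
    exact propext (SimpleGraph.Iso.map_adj_iff σ).symm

/-- If the leader is adjacent to every follower and there is more than one follower, then the
system is not controllable. -/
theorem not_isControllable_of_forall_adj (h₁ : ∀ i, i ≠ v₁ → G.Adj v₁ i) {p q : V}
    (hp : p ≠ v₁) (hq : q ≠ v₁) (hpq : p ≠ q) : ¬ IsControllable G {v₁} := by
  intro h
  let S : Submodule ℝ ({i // i ∉ ({v₁} : Finset V)} → ℝ) := Submodule.span ℝ {1}
  have hone : (1 : {i // i ∉ ({v₁} : Finset V)} → ℝ) ∈ S := Submodule.mem_span_singleton_self _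
  have hadj : ∀ i : {i // i ∉ ({v₁} : Finset V)}, G.Adj i.1 v₁ :=
    fun i => (h₁ i.1 (by simpa using i.2)).symm
  -- On the constant profile only the edge to the leader contributes, with difference 1 - 0.
  have hF : followerMatrix G {v₁} *ᵥ 1 = 1 := by
    ext i
    rw [followerMatrix_mulVec, Fintype.sum_eq_single v₁]
    · simp [hadj i]
    · intro k hk
      have := extendZero_coe (v₁ := v₁) 1 ⟨k, by simpa using hk⟩
      simp only at this
      simp [this]
  have htop := eq_top_of_linearControllable _ _ h S (fun x hx => ?_) (fun u => ?_)
  · have h1 : Pi.single ⟨p, by simpa using hp⟩ 1 ∈ S := htop ▸ Submodule.mem_top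
    obtain ⟨c, hc⟩ := Submodule.mem_span_singleton.1 h1
    have h2 := congrFun hc ⟨p, by simpa using hp⟩
    have h3 := congrFun hc ⟨q, by simpa using hq⟩
    simp [hpq.symm] at h2 h3
    simp [h2] at h3
  · obtain ⟨c, rfl⟩ := Submodule.mem_span_singleton.1 hx
    rw [mulVec_smul, neg_mulVec, hF]
    exact S.smul_mem _ (S.neg_mem hone)
  · refine Submodule.mem_span_singleton.2 ⟨u ⟨v₁, Finset.mem_singleton_self v₁⟩, ?_⟩
    ext i
    rw [leaderMatrix_mulVec, if_pos (hadj i)]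
    simp

variable {G}

/-- The transposition of p and q is a graph automorphism fixing the leader. -/
theorem IsDCD.not_isControllable {p q : V} (h : IsDCD G p q) (hp : p ≠ v₁) (hq : q ≠ v₁) :
    ¬ IsControllable G {v₁} := by
  obtain ⟨hpq, h⟩ := isDCD_iff.1 h
  have h' : ∀ k, k ≠ p → k ≠ q → (G.Adj p k ↔ G.Adj q k) := fun k hkp hkq => by
    rw [G.adj_comm p, G.adj_comm q]
    exact h k hkp hkq
  let σ : G ≃g G :=
    { toEquiv := Equiv.swap p q
      map_rel_iff' := by
        intro a b
        simp only [Equiv.swap_apply_def]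
        have hp := h' a
        have hq := h' b
        split_ifs <;> simp_all [G.adj_comm] }
  refine not_isControllable_of_iso G σ (Equiv.swap_apply_of_ne_of_ne hp.symm hq.symm) (p := p) ?_
  simpa [σ] using hpq.symm

/-- The reflection `s₁ ↔ s₂`, `t₁ ↔ t₂` of four vertices destroys controllability if it preserves
adjacency. -/
theorem not_isControllable_of_reflection {s₁ s₂ t₁ t₂ : V}
    (hnd : [v₁, s₁, s₂, t₁, t₂].Nodup) (hall : ∀ v, v ∈ [v₁, s₁, s₂, t₁, t₂])
    (hks : G.Adj v₁ s₁ ↔ G.Adj v₁ s₂) (hkt : G.Adj v₁ t₁ ↔ G.Adj v₁ t₂)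
    (hst : G.Adj s₁ t₁ ↔ G.Adj s₂ t₂) (hts : G.Adj s₁ t₂ ↔ G.Adj s₂ t₁) :
    ¬ IsControllable G {v₁} := by
  simp only [List.nodup_cons, List.mem_cons, List.not_mem_nil, or_false, not_or, not_false_eq_true,
    List.nodup_nil, and_true] at hnd hall
  obtain ⟨⟨h1, h2, h3, h4⟩, ⟨h5, h6, h7⟩, ⟨h8, h9⟩, h10⟩ := hnd
  let e : V ≃ V := (Equiv.swap s₁ s₂).trans (Equiv.swap t₁ t₂)
  have e0 : e v₁ = v₁ := by simp [e, Equiv.swap_apply_def, *]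
  have e1 : e s₁ = s₂ := by simp [e, Equiv.swap_apply_def, *]
  have e2 : e s₂ = s₁ := by simp [e, Equiv.swap_apply_def, *]
  have e3 : e t₁ = t₂ := by simp [e, Equiv.swap_apply_def, *, Ne.symm]
  have e4 : e t₂ = t₁ := by simp [e, Equiv.swap_apply_def, *, Ne.symm]
  let σ : G ≃g G :=
    { toEquiv := e
      map_rel_iff' := by
        intro a b
        rcases hall a with rfl | rfl | rfl | rfl | rfl <;>
        rcases hall b with rfl | rfl | rfl | rfl | rfl <;>
        simp only [e0, e1, e2, e3, e4] <;> grind [G.adj_comm, G.irrefl] }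
  exact not_isControllable_of_iso G σ e0 (p := s₁) (e1.trans_ne (Ne.symm h5))

theorem IsQCD.not_isControllable (h : IsQCD G ({v₁}ᶜ : Finset V)) :
    ¬ IsControllable G {v₁} := by
  obtain ⟨k, s₁, s₂, t₁, t₂, hnd, hall, hQ, h⟩ := h
  have hnd' := hnd
  simp only [List.nodup_cons, List.mem_cons, List.not_mem_nil, or_false, not_or, not_false_eq_true,
    List.nodup_nil, and_true] at hnd'
  obtain ⟨⟨h1, h2, h3, h4⟩, ⟨h5, h6, h7⟩, ⟨h8, h9⟩, h10⟩ := hnd'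
  have hk : v₁ = k := by
    have : k ∉ ({v₁}ᶜ : Finset V) := by simp [*]
    simpa [eq_comm] using this
  subst hk
  rcases h with ⟨ha, hb, hc, hd⟩ | h
  · refine not_isControllable_of_forall_adj G (fun i hi => ?_) (Ne.symm h1) (Ne.symm h2) h5
    have hi' := hall i
    simp only [List.mem_cons, List.not_mem_nil, or_false] at hi'
    rcases hi' with rfl | rfl | rfl | rfl | rfl
    exacts [(hi rfl).elim, ha, hb, hc, hd]
  -- Each of the four remaining edge sets is invariant under s₁ ↔ s₂, t₁ ↔ t₂.
  · refine not_isControllable_of_reflection hnd hall ?_ ?_ ?_ ?_ <;>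
    rcases h with h | h | h | h <;>
    simp only [← SimpleGraph.mem_edgeSet, h] <;>
    simp [h1, h2, h3, h4, h5, h6, h7, h8, h9, h10, Ne.symm h1, Ne.symm h2, Ne.symm h3, Ne.symm h4,
      Ne.symm h5, Ne.symm h6, Ne.symm h7, Ne.symm h8, Ne.symm h9, Ne.symm h10]

end Followers

/-! ### The Boolean model and its exhaustive check -/

/-- One application of the follower matrix to the follower values `u₁, u₂, u₃, u₄`. -/
def followerStep (x₁ x₂ x₃ x₄ y₁₂ y₁₃ y₁₄ y₂₃ y₂₄ y₃₄ : Bool) (u : ℤ × ℤ × ℤ × ℤ) :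
    ℤ × ℤ × ℤ × ℤ :=
  (cond x₁ u.1 0 + cond y₁₂ (u.1 - u.2.1) 0 + cond y₁₃ (u.1 - u.2.2.1) 0 +
      cond y₁₄ (u.1 - u.2.2.2) 0,
    cond x₂ u.2.1 0 + cond y₁₂ (u.2.1 - u.1) 0 + cond y₂₃ (u.2.1 - u.2.2.1) 0 +
      cond y₂₄ (u.2.1 - u.2.2.2) 0,
    cond x₃ u.2.2.1 0 + cond y₁₃ (u.2.2.1 - u.1) 0 + cond y₂₃ (u.2.2.1 - u.2.1) 0 +
      cond y₃₄ (u.2.2.1 - u.2.2.2) 0,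
    cond x₄ u.2.2.2 0 + cond y₁₄ (u.2.2.2 - u.1) 0 + cond y₂₄ (u.2.2.2 - u.2.1) 0 +
      cond y₃₄ (u.2.2.2 - u.2.2.1) 0)

/-- The determinant of the matrix with columns `w, x, y, z`. -/
def colDet (w x y z : ℤ × ℤ × ℤ × ℤ) : ℤ :=
  (w.1 * x.2.1 - x.1 * w.2.1) * (y.2.2.1 * z.2.2.2 - z.2.2.1 * y.2.2.2) -
  (w.1 * x.2.2.1 - x.1 * w.2.2.1) * (y.2.1 * z.2.2.2 - z.2.1 * y.2.2.2) +
  (w.1 * x.2.2.2 - x.1 * w.2.2.2) * (y.2.1 * z.2.2.1 - z.2.1 * y.2.2.1) +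
  (w.2.1 * x.2.2.1 - x.2.1 * w.2.2.1) * (y.1 * z.2.2.2 - z.1 * y.2.2.2) -
  (w.2.1 * x.2.2.2 - x.2.1 * w.2.2.2) * (y.1 * z.2.2.1 - z.1 * y.2.2.1) +
  (w.2.2.1 * x.2.2.2 - x.2.2.1 * w.2.2.2) * (y.1 * z.2.1 - z.1 * y.2.1)

/-- The determinant of the Krylov matrix of the follower system. -/
def krylovDet (x₁ x₂ x₃ x₄ y₁₂ y₁₃ y₁₄ y₂₃ y₂₄ y₃₄ : Bool) : ℤ :=
  let w := (cond x₁ 1 0, cond x₂ 1 0, cond x₃ 1 0, cond x₄ 1 0)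
  let x := followerStep x₁ x₂ x₃ x₄ y₁₂ y₁₃ y₁₄ y₂₃ y₂₄ y₃₄ w
  let y := followerStep x₁ x₂ x₃ x₄ y₁₂ y₁₃ y₁₄ y₂₃ y₂₄ y₃₄ x
  let z := followerStep x₁ x₂ x₃ x₄ y₁₂ y₁₃ y₁₄ y₂₃ y₂₄ y₃₄ y
  colDet w x y z

/-- The DCD condition for the followers `1, 2`, by adjacencies to the leader (`x`) and between
followers (`y`). -/
def dcdTest (x₁ x₂ y₁₃ y₁₄ y₂₃ y₂₄ : Bool) : Bool :=
  x₁ == x₂ && y₁₃ == y₂₃ && y₁₄ == y₂₄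

/-- The QCD condition with `s₁, s₂, t₁, t₂` the followers `1, 2, 3, 4`. -/
def qcdTest (x₁ x₂ x₃ x₄ y₁₂ y₁₃ y₁₄ y₂₃ y₂₄ y₃₄ : Bool) : Bool :=
  (x₁ && x₂ && x₃ && x₄) ||
  (x₁ && x₂ && !x₃ && !x₄ && y₁₂ && y₁₃ && !y₁₄ && !y₂₃ && y₂₄ && !y₃₄) ||
  (!x₁ && !x₂ && x₃ && x₄ && y₁₂ && y₁₃ && !y₁₄ && !y₂₃ && y₂₄ && !y₃₄) ||
  (x₁ && x₂ && !x₃ && !x₄ && y₁₂ && !y₁₃ && y₁₄ && y₂₃ && !y₂₄ && y₃₄) ||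
  (x₁ && x₂ && !x₃ && !x₄ && !y₁₂ && !y₁₃ && y₁₄ && y₂₃ && !y₂₄ && !y₃₄)

/-- Some vertex is isolated, or two followers are DCD, or the followers are QCD. -/
def destructiveTest (x₁ x₂ x₃ x₄ y₁₂ y₁₃ y₁₄ y₂₃ y₂₄ y₃₄ : Bool) : Bool :=
  -- Absence of isolated vertices can replace connectedness: if the graph is then still
  -- disconnected, a component without the leader has two or three vertices and contains a DCD pair.
  !(x₁ || x₂ || x₃ || x₄) || !(x₁ || y₁₂ || y₁₃ || y₁₄) || !(x₂ || y₁₂ || y₂₃ || y₂₄) ||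
  !(x₃ || y₁₃ || y₂₃ || y₃₄) || !(x₄ || y₁₄ || y₂₄ || y₃₄) ||
  dcdTest x₁ x₂ y₁₃ y₁₄ y₂₃ y₂₄ || dcdTest x₁ x₃ y₁₂ y₁₄ y₂₃ y₃₄ ||
  dcdTest x₁ x₄ y₁₂ y₁₃ y₂₄ y₃₄ || dcdTest x₂ x₃ y₁₂ y₂₄ y₁₃ y₃₄ ||
  dcdTest x₂ x₄ y₁₂ y₂₃ y₁₄ y₃₄ || dcdTest x₃ x₄ y₁₃ y₂₃ y₁₄ y₂₄ ||
  -- The double swap preserves `qcdTest`, so the twelve namings with s₁ before s₂ suffice.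
  qcdTest x₁ x₂ x₃ x₄ y₁₂ y₁₃ y₁₄ y₂₃ y₂₄ y₃₄ || qcdTest x₁ x₂ x₄ x₃ y₁₂ y₁₄ y₁₃ y₂₄ y₂₃ y₃₄ ||
  qcdTest x₁ x₃ x₂ x₄ y₁₃ y₁₂ y₁₄ y₂₃ y₃₄ y₂₄ || qcdTest x₁ x₃ x₄ x₂ y₁₃ y₁₄ y₁₂ y₃₄ y₂₃ y₂₄ ||
  qcdTest x₁ x₄ x₂ x₃ y₁₄ y₁₂ y₁₃ y₂₄ y₃₄ y₂₃ || qcdTest x₁ x₄ x₃ x₂ y₁₄ y₁₃ y₁₂ y₃₄ y₂₄ y₂₃ ||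
  qcdTest x₂ x₃ x₁ x₄ y₂₃ y₁₂ y₂₄ y₁₃ y₃₄ y₁₄ || qcdTest x₂ x₃ x₄ x₁ y₂₃ y₂₄ y₁₂ y₃₄ y₁₃ y₁₄ ||
  qcdTest x₂ x₄ x₁ x₃ y₂₄ y₁₂ y₂₃ y₁₄ y₃₄ y₁₃ || qcdTest x₂ x₄ x₃ x₁ y₂₄ y₂₃ y₁₂ y₃₄ y₁₄ y₁₃ ||
  qcdTest x₃ x₄ x₁ x₂ y₃₄ y₁₃ y₂₃ y₁₄ y₂₄ y₁₂ || qcdTest x₃ x₄ x₂ x₁ y₃₄ y₂₃ y₁₃ y₂₄ y₁₄ y₁₂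

/-- On five vertices without isolated ones, the Krylov determinant vanishes only for DCD or QCD
followers. -/
theorem krylovDet_ne_zero_or_destructiveTest : ∀ x₁ x₂ x₃ x₄ y₁₂ y₁₃ y₁₄ y₂₃ y₂₄ y₃₄ : Bool,
    (destructiveTest x₁ x₂ x₃ x₄ y₁₂ y₁₃ y₁₄ y₂₃ y₂₄ y₃₄ ||
      !(krylovDet x₁ x₂ x₃ x₄ y₁₂ y₁₃ y₁₄ y₂₃ y₂₄ y₃₄ == 0)) = true := by
  decide +kernel

/-- Columns with nonzero determinant span. -/
theorem exists_smul_add_of_colDet_ne_zero {w x y z : ℤ × ℤ × ℤ × ℤ} (h : colDet w x y z ≠ 0)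
    (t₁ t₂ t₃ t₄ : ℝ) : ∃ a b c d : ℝ,
      a * w.1 + b * x.1 + c * y.1 + d * z.1 = t₁ ∧
      a * w.2.1 + b * x.2.1 + c * y.2.1 + d * z.2.1 = t₂ ∧
      a * w.2.2.1 + b * x.2.2.1 + c * y.2.2.1 + d * z.2.2.1 = t₃ ∧
      a * w.2.2.2 + b * x.2.2.2 + c * y.2.2.2 + d * z.2.2.2 = t₄ := by
  let M : Matrix (Fin 4) (Fin 4) ℝ :=
    !![(w.1 : ℝ), x.1, y.1, z.1; w.2.1, x.2.1, y.2.1, z.2.1;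
      w.2.2.1, x.2.2.1, y.2.2.1, z.2.2.1; w.2.2.2, x.2.2.2, y.2.2.2, z.2.2.2]
  have hdet : M.det = colDet w x y z := by
    simp [M, Matrix.det_succ_row_zero, Fin.sum_univ_succ, Fin.succAbove, colDet]
    ring
  have hunit : IsUnit M.det := by
    rw [hdet, isUnit_iff_ne_zero]
    exact_mod_cast h
  have hmul : M *ᵥ (M⁻¹ *ᵥ ![t₁, t₂, t₃, t₄]) = ![t₁, t₂, t₃, t₄] := by
    rw [mulVec_mulVec, mul_nonsing_inv M hunit, one_mulVec]
  generalize M⁻¹ *ᵥ ![t₁, t₂, t₃, t₄] = c at hmul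
  refine ⟨c 0, c 1, c 2, c 3, ?_, ?_, ?_, ?_⟩
  · have := congrFun hmul 0
    simp [M, mulVec, dotProduct, Fin.sum_univ_four] at this
    linarith
  · have := congrFun hmul 1
    simp [M, mulVec, dotProduct, Fin.sum_univ_four] at this
    linarith
  · have := congrFun hmul 2
    simp [M, mulVec, dotProduct, Fin.sum_univ_four] at this
    linarith
  · have := congrFun hmul 3
    simp [M, mulVec, dotProduct, Fin.sum_univ_four] at this
    linarith

/-! ### Transfer between labelled graphs and Booleans -/

section Edges

variable {G : SimpleGraph V}

/-- The edge set of a graph on five vertices is determined by the ten adjacencies. -/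
theorem edgeSet_eq_of_forall {k s₁ s₂ t₁ t₂ : V} (hall : ∀ v, v ∈ [k, s₁, s₂, t₁, t₂])
    {E : Set (Sym2 V)} (hE : ∀ e ∈ E, ¬ e.IsDiag)
    (h : ∀ e ∈ [s(k, s₁), s(k, s₂), s(k, t₁), s(k, t₂), s(s₁, s₂), s(s₁, t₁), s(s₁, t₂),
      s(s₂, t₁), s(s₂, t₂), s(t₁, t₂)], e ∈ G.edgeSet ↔ e ∈ E) : G.edgeSet = E := by
  ext e
  induction e using Sym2.ind with | _ v w =>
  by_cases hvw : v = w
  · subst hvw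
    exact iff_of_false (by simp) fun he => hE _ he rfl
  refine h _ ?_
  have hv := hall v
  have hw := hall w
  simp only [List.mem_cons, List.not_mem_nil, or_false] at hv hw ⊢
  rcases hv with rfl | rfl | rfl | rfl | rfl <;> rcases hw with rfl | rfl | rfl | rfl | rfl <;>
  first
    | exact (hvw rfl).elim
    | simp [Sym2.eq_swap]

end Edges

section LabelledAdj

variable (f : Fin 5 ≃ V) (G : SimpleGraph V) [DecidableRel G.Adj]

/-- The adjacency of two labelled vertices. -/
def labelledAdj (i j : Fin 5) : Bool := decide (G.Adj (f i) (f j))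

variable {f} {G}

theorem label_notMem {v₁ : V} (hf : f 0 = v₁) {i : Fin 5} (hi : i ≠ 0) :
    f i ∉ ({v₁} : Finset V) := by
  rw [Finset.mem_singleton]
  exact fun h => hi (f.injective (h.trans hf.symm))

theorem labelledAdj_comm (i j : Fin 5) : labelledAdj f G i j = labelledAdj f G j i := by
  simp [labelledAdj, G.adj_comm]

theorem labelledAdj_self (i : Fin 5) : labelledAdj f G i i = false := by
  simp [labelledAdj]

/-- In a connected graph each labelled vertex has a neighbour. -/
theorem labelledAdj_of_connected (hG : G.Connected) (i : Fin 5) :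
    labelledAdj f G i 0 = true ∨ labelledAdj f G i 1 = true ∨ labelledAdj f G i 2 = true ∨
      labelledAdj f G i 3 = true ∨ labelledAdj f G i 4 = true := by
  have : Nontrivial V := f.symm.nontrivial
  obtain ⟨w, hw⟩ := hG.preconnected.exists_adj_of_nontrivial (f i)
  obtain ⟨j, rfl⟩ := f.surjective w
  have hj : labelledAdj f G i j = true := by simpa [labelledAdj] using hw
  fin_cases j <;> simp_all

theorem isDCD_of_dcdTest {p q r s : Fin 5} (hpq : p ≠ q) (hall : ∀ i, i ∈ [0, p, q, r, s])
    (h : dcdTest (labelledAdj f G 0 p) (labelledAdj f G 0 q) (labelledAdj f G p r)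
      (labelledAdj f G p s) (labelledAdj f G q r) (labelledAdj f G q s) = true) :
    IsDCD G (f p) (f q) := by
  rw [isDCD_iff]
  refine ⟨f.injective.ne hpq, fun k hkp hkq => ?_⟩
  obtain ⟨i, rfl⟩ := f.surjective k
  simp only [dcdTest, labelledAdj, Bool.and_eq_true, beq_iff_eq, decide_eq_decide] at h
  have hi := hall i
  simp only [List.mem_cons, List.not_mem_nil, or_false] at hi
  rcases hi with rfl | rfl | rfl | rfl | rfl
  · exact h.1.1
  · exact (hkp rfl).elim
  · exact (hkq rfl).elim
  · simpa only [G.adj_comm (f i)] using h.1.2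
  · simpa only [G.adj_comm (f i)] using h.2

end LabelledAdj

section Labelled

variable [DecidableEq V] {v₁ : V}

/-- The follower values `y` are `u` in the labelling `f`. -/
def HasFollowerValues (f : Fin 5 ≃ V) (y : {i // i ∉ ({v₁} : Finset V)} → ℝ)
    (u : ℤ × ℤ × ℤ × ℤ) : Prop :=
  extendZero v₁ y (f 1) = u.1 ∧ extendZero v₁ y (f 2) = u.2.1 ∧
    extendZero v₁ y (f 3) = u.2.2.1 ∧ extendZero v₁ y (f 4) = u.2.2.2

variable {f : Fin 5 ≃ V}

theorem extendZero_apply_label (hf : f 0 = v₁) (y : {i // i ∉ ({v₁} : Finset V)} → ℝ) {i : Fin 5}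
    (hi : i ≠ 0) :
    extendZero v₁ y (f i) = y ⟨f i, label_notMem hf hi⟩ :=
  extendZero_coe y ⟨f i, label_notMem hf hi⟩

variable [Fintype V] {G : SimpleGraph V} [DecidableRel G.Adj]

/-- Iterating this identifies the real Krylov vectors with the integer columns of `krylovDet`. -/
theorem HasFollowerValues.step (hf : f 0 = v₁) {y : {i // i ∉ ({v₁} : Finset V)} → ℝ}
    {u : ℤ × ℤ × ℤ × ℤ} (h : HasFollowerValues f y u) :
    HasFollowerValues f (followerMatrix G {v₁} *ᵥ y)
      (followerStep (labelledAdj f G 0 1) (labelledAdj f G 0 2) (labelledAdj f G 0 3)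
        (labelledAdj f G 0 4) (labelledAdj f G 1 2) (labelledAdj f G 1 3) (labelledAdj f G 1 4)
        (labelledAdj f G 2 3) (labelledAdj f G 2 4) (labelledAdj f G 3 4) u) := by
  have hF : ∀ i, i ≠ 0 → extendZero v₁ (followerMatrix G {v₁} *ᵥ y) (f i) =
      ∑ k, if G.Adj (f i) (f k) then
        extendZero v₁ y (f i) - extendZero v₁ y (f k) else 0 := by
    intro i hi
    rw [extendZero_apply_label hf _ hi, followerMatrix_mulVec, extendZero_apply_label hf _ hi,
      ← Equiv.sum_comp f]
  obtain ⟨h1, h2, h3, h4⟩ := h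
  have h0 : extendZero v₁ y (f 0) = 0 := by rw [hf, extendZero_leader]
  refine ⟨?_, ?_, ?_, ?_⟩ <;> rw [hF _ (by decide), Fin.sum_univ_five] <;>
  simp only [h0, h1, h2, h3, h4, followerStep, labelledAdj, Bool.cond_decide, SimpleGraph.irrefl,
    G.adj_comm (f 1) (f 0), G.adj_comm (f 2) (f 0), G.adj_comm (f 3) (f 0), G.adj_comm (f 4) (f 0),
    G.adj_comm (f 2) (f 1), G.adj_comm (f 3) (f 1), G.adj_comm (f 4) (f 1),
    G.adj_comm (f 3) (f 2), G.adj_comm (f 4) (f 2), G.adj_comm (f 4) (f 3)] <;>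
  push_cast <;> simp

theorem hasFollowerValues_leaderMatrix (hf : f 0 = v₁) :
    HasFollowerValues f (-leaderMatrix G {v₁} *ᵥ 1)
      (cond (labelledAdj f G 0 1) 1 0, cond (labelledAdj f G 0 2) 1 0,
        cond (labelledAdj f G 0 3) 1 0, cond (labelledAdj f G 0 4) 1 0) := by
  refine ⟨?_, ?_, ?_, ?_⟩ <;>
  rw [extendZero_apply_label hf _ (by decide), leaderMatrix_mulVec] <;>
  simp [labelledAdj, hf, Bool.cond_decide, G.adj_comm v₁]

/-- The system is controllable when the Krylov determinant does not vanish. -/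
theorem isControllable_of_krylovDet_ne_zero (hf : f 0 = v₁)
    (h : krylovDet (labelledAdj f G 0 1) (labelledAdj f G 0 2) (labelledAdj f G 0 3)
        (labelledAdj f G 0 4) (labelledAdj f G 1 2) (labelledAdj f G 1 3) (labelledAdj f G 1 4)
        (labelledAdj f G 2 3) (labelledAdj f G 2 4) (labelledAdj f G 3 4) ≠ 0) :
    IsControllable G {v₁} := by
  refine linearControllable_of_forall_eq_top _ _ fun S hA hB => eq_top_iff.2 fun t _ => ?_
  -- Invariance under -F is invariance under F, so the Krylov columns may be formed without signs.
  have hF : ∀ y ∈ S, followerMatrix G {v₁} *ᵥ y ∈ S := fun y hy => by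
    simpa [neg_mulVec] using hA y hy
  have h0 := hasFollowerValues_leaderMatrix (G := G) hf
  have m0 := hB 1
  have m1 := hF _ m0
  have m2 := hF _ m1
  have m3 := hF _ m2
  have h1 := h0.step (G := G) hf
  have h2 := h1.step (G := G) hf
  have h3 := h2.step (G := G) hf
  obtain ⟨a, b, c, d, e1, e2, e3, e4⟩ := exists_smul_add_of_colDet_ne_zero h
    (extendZero v₁ t (f 1)) (extendZero v₁ t (f 2)) (extendZero v₁ t (f 3))
    (extendZero v₁ t (f 4))
  have key := S.add_mem (S.add_mem (S.add_mem (S.smul_mem a m0) (S.smul_mem b m1))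
    (S.smul_mem c m2)) (S.smul_mem d m3)
  convert key using 1
  ext ⟨i, hi⟩
  rw [← extendZero_coe t, ← extendZero_coe (_ + _)]
  obtain ⟨j, rfl⟩ := f.surjective i
  have hj : j ≠ 0 := by
    rintro rfl
    simp [hf] at hi
  simp only [map_add, map_smul, Pi.add_apply, Pi.smul_apply, smul_eq_mul]
  fin_cases j
  · exact (hj rfl).elim
  · exact e1.symm.trans (by rw [← h0.1, ← h1.1, ← h2.1, ← h3.1]; rfl)
  · exact e2.symm.trans (by rw [← h0.2.1, ← h1.2.1, ← h2.2.1, ← h3.2.1]; rfl)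
  · exact e3.symm.trans (by rw [← h0.2.2.1, ← h1.2.2.1, ← h2.2.2.1, ← h3.2.2.1]; rfl)
  · exact e4.symm.trans (by rw [← h0.2.2.2, ← h1.2.2.2, ← h2.2.2.2, ← h3.2.2.2]; rfl)

theorem isQCD_of_qcdTest (hf : f 0 = v₁) {i₁ i₂ j₁ j₂ : Fin 5}
    (hnd : [0, i₁, i₂, j₁, j₂].Nodup) (hall : ∀ i, i ∈ [0, i₁, i₂, j₁, j₂])
    (h : qcdTest (labelledAdj f G 0 i₁) (labelledAdj f G 0 i₂) (labelledAdj f G 0 j₁)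
      (labelledAdj f G 0 j₂) (labelledAdj f G i₁ i₂) (labelledAdj f G i₁ j₁)
      (labelledAdj f G i₁ j₂) (labelledAdj f G i₂ j₁) (labelledAdj f G i₂ j₂)
      (labelledAdj f G j₁ j₂) = true) :
    IsQCD G ({v₁}ᶜ : Finset V) := by
  have hnd' : [f 0, f i₁, f i₂, f j₁, f j₂].Nodup := by
    simpa using hnd.map f.injective
  have hall' : ∀ v, v ∈ [f 0, f i₁, f i₂, f j₁, f j₂] := fun v => by
    obtain ⟨i, rfl⟩ := f.surjective v
    exact List.mem_map_of_mem (f := f) (hall i)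
  have hne := hnd'
  simp only [List.nodup_cons, List.mem_cons, List.not_mem_nil, or_false, not_or, not_false_eq_true,
    List.nodup_nil, and_true] at hne
  subst hf
  obtain ⟨⟨h1, h2, h3, h4⟩, ⟨h5, h6, h7⟩, ⟨h8, h9⟩, h10⟩ := hne
  refine ⟨f 0, f i₁, f i₂, f j₁, f j₂, hnd', hall', ?_, ?_⟩
  · ext v
    have hv := hall' v
    simp only [List.mem_cons, List.not_mem_nil, or_false] at hv
    simp only [Finset.mem_compl, Finset.mem_singleton, Finset.mem_insert]
    refine ⟨fun hne => hv.resolve_left hne, ?_⟩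
    rintro (rfl | rfl | rfl | rfl)
    exacts [Ne.symm h1, Ne.symm h2, Ne.symm h3, Ne.symm h4]
  · simp only [qcdTest, labelledAdj, Bool.or_eq_true, Bool.and_eq_true, Bool.not_eq_true',
      decide_eq_true_eq, decide_eq_false_iff_not, or_assoc, and_assoc] at h
    refine h.imp id (Or.imp ?_ (Or.imp ?_ (Or.imp ?_ ?_))) <;>
    · rintro ⟨a1, a2, a3, a4, a5, a6, a7, a8, a9, a10⟩
      refine edgeSet_eq_of_forall hall' ?_ ?_ <;>
      simp [-EmbeddingLike.apply_eq_iff_eq, *,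
        Ne.symm h1, Ne.symm h2, Ne.symm h3, Ne.symm h4, Ne.symm h5, Ne.symm h6, Ne.symm h7,
        Ne.symm h8, Ne.symm h9, Ne.symm h10]

theorem destructive_of_destructiveTest (hf : f 0 = v₁) (hG : G.Connected)
    (h : destructiveTest (labelledAdj f G 0 1) (labelledAdj f G 0 2) (labelledAdj f G 0 3)
        (labelledAdj f G 0 4) (labelledAdj f G 1 2) (labelledAdj f G 1 3) (labelledAdj f G 1 4)
        (labelledAdj f G 2 3) (labelledAdj f G 2 4) (labelledAdj f G 3 4) = true) :
    IsQCD G ({v₁}ᶜ : Finset V) ∨ ∃ p q, p ≠ v₁ ∧ q ≠ v₁ ∧ IsDCD G p q := by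
  have hne : ∀ i, i ≠ 0 → f i ≠ v₁ := fun i hi h => hi (f.injective (h.trans hf.symm))
  have c : ∀ i j, labelledAdj f G i j = labelledAdj f G j i := labelledAdj_comm
  have n := labelledAdj_of_connected (f := f) hG
  have n0 := n 0
  have n1 := n 1
  have n2 := n 2
  have n3 := n 3
  have n4 := n 4
  -- Label pairs are put in increasing order, as in the arguments of the test.
  simp only [labelledAdj_self, c 1 0, c 2 0, c 3 0, c 4 0, c 2 1, c 3 1, c 4 1, c 3 2, c 4 2, c 4 3,
    Bool.false_eq_true, false_or, or_false] at n0 n1 n2 n3 n4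
  simp only [destructiveTest, Bool.or_eq_true, Bool.not_eq_true', Bool.or_eq_false_iff,
    or_assoc, and_assoc] at h
  rcases h with h | h | h | h | h | h | h | h | h | h | h | h | h |
    h | h | h | h | h | h | h | h | h | h
  -- The five isolated-vertex alternatives contradict connectedness.
  iterate 5 · simp_all
  · exact .inr ⟨f 1, f 2, hne _ (by decide), hne _ (by decide),
      isDCD_of_dcdTest (r := 3) (s := 4) (by decide) (by decide)
        (by simpa only [c 2 1, c 3 1, c 4 1, c 3 2, c 4 2, c 4 3] using h)⟩
  · exact .inr ⟨f 1, f 3, hne _ (by decide), hne _ (by decide),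
      isDCD_of_dcdTest (r := 2) (s := 4) (by decide) (by decide)
        (by simpa only [c 2 1, c 3 1, c 4 1, c 3 2, c 4 2, c 4 3] using h)⟩
  · exact .inr ⟨f 1, f 4, hne _ (by decide), hne _ (by decide),
      isDCD_of_dcdTest (r := 2) (s := 3) (by decide) (by decide)
        (by simpa only [c 2 1, c 3 1, c 4 1, c 3 2, c 4 2, c 4 3] using h)⟩
  · exact .inr ⟨f 2, f 3, hne _ (by decide), hne _ (by decide),
      isDCD_of_dcdTest (r := 1) (s := 4) (by decide) (by decide)
        (by simpa only [c 2 1, c 3 1, c 4 1, c 3 2, c 4 2, c 4 3] using h)⟩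
  · exact .inr ⟨f 2, f 4, hne _ (by decide), hne _ (by decide),
      isDCD_of_dcdTest (r := 1) (s := 3) (by decide) (by decide)
        (by simpa only [c 2 1, c 3 1, c 4 1, c 3 2, c 4 2, c 4 3] using h)⟩
  · exact .inr ⟨f 3, f 4, hne _ (by decide), hne _ (by decide),
      isDCD_of_dcdTest (r := 1) (s := 2) (by decide) (by decide)
        (by simpa only [c 2 1, c 3 1, c 4 1, c 3 2, c 4 2, c 4 3] using h)⟩
  · exact .inl (isQCD_of_qcdTest hf (i₁ := 1) (i₂ := 2) (j₁ := 3) (j₂ := 4) (by decide)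
      (by decide) (by simpa only [c 2 1, c 3 1, c 4 1, c 3 2, c 4 2, c 4 3] using h))
  · exact .inl (isQCD_of_qcdTest hf (i₁ := 1) (i₂ := 2) (j₁ := 4) (j₂ := 3) (by decide)
      (by decide) (by simpa only [c 2 1, c 3 1, c 4 1, c 3 2, c 4 2, c 4 3] using h))
  · exact .inl (isQCD_of_qcdTest hf (i₁ := 1) (i₂ := 3) (j₁ := 2) (j₂ := 4) (by decide)
      (by decide) (by simpa only [c 2 1, c 3 1, c 4 1, c 3 2, c 4 2, c 4 3] using h))
  · exact .inl (isQCD_of_qcdTest hf (i₁ := 1) (i₂ := 3) (j₁ := 4) (j₂ := 2) (by decide)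
      (by decide) (by simpa only [c 2 1, c 3 1, c 4 1, c 3 2, c 4 2, c 4 3] using h))
  · exact .inl (isQCD_of_qcdTest hf (i₁ := 1) (i₂ := 4) (j₁ := 2) (j₂ := 3) (by decide)
      (by decide) (by simpa only [c 2 1, c 3 1, c 4 1, c 3 2, c 4 2, c 4 3] using h))
  · exact .inl (isQCD_of_qcdTest hf (i₁ := 1) (i₂ := 4) (j₁ := 3) (j₂ := 2) (by decide)
      (by decide) (by simpa only [c 2 1, c 3 1, c 4 1, c 3 2, c 4 2, c 4 3] using h))
  · exact .inl (isQCD_of_qcdTest hf (i₁ := 2) (i₂ := 3) (j₁ := 1) (j₂ := 4) (by decide)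
      (by decide) (by simpa only [c 2 1, c 3 1, c 4 1, c 3 2, c 4 2, c 4 3] using h))
  · exact .inl (isQCD_of_qcdTest hf (i₁ := 2) (i₂ := 3) (j₁ := 4) (j₂ := 1) (by decide)
      (by decide) (by simpa only [c 2 1, c 3 1, c 4 1, c 3 2, c 4 2, c 4 3] using h))
  · exact .inl (isQCD_of_qcdTest hf (i₁ := 2) (i₂ := 4) (j₁ := 1) (j₂ := 3) (by decide)
      (by decide) (by simpa only [c 2 1, c 3 1, c 4 1, c 3 2, c 4 2, c 4 3] using h))
  · exact .inl (isQCD_of_qcdTest hf (i₁ := 2) (i₂ := 4) (j₁ := 3) (j₂ := 1) (by decide)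
      (by decide) (by simpa only [c 2 1, c 3 1, c 4 1, c 3 2, c 4 2, c 4 3] using h))
  · exact .inl (isQCD_of_qcdTest hf (i₁ := 3) (i₂ := 4) (j₁ := 1) (j₂ := 2) (by decide)
      (by decide) (by simpa only [c 2 1, c 3 1, c 4 1, c 3 2, c 4 2, c 4 3] using h))
  · exact .inl (isQCD_of_qcdTest hf (i₁ := 3) (i₂ := 4) (j₁ := 2) (j₂ := 1) (by decide)
      (by decide) (by simpa only [c 2 1, c 3 1, c 4 1, c 3 2, c 4 2, c 4 3] using h))

end Labelled

end MultiAgent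

/-! ### The characterization -/

theorem theorem4 {V : Type*} [Fintype V] [DecidableEq V] (hV : Fintype.card V = 5)
    (G : SimpleGraph V) [DecidableRel G.Adj] (hG : G.Connected) (v₁ : V) :
    MultiAgent.IsControllable G {v₁} ↔
      ¬ MultiAgent.IsQCD G ({v₁}ᶜ : Finset V) ∧
      (∀ p q r : V, p ≠ v₁ → q ≠ v₁ → r ≠ v₁ → ¬ MultiAgent.IsTCD G {v₁} p q r) ∧
      (∀ p q : V, p ≠ v₁ → q ≠ v₁ → ¬ MultiAgent.IsDCD G p q) := by
  constructor
  · intro h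
    have hD : ∀ p q : V, p ≠ v₁ → q ≠ v₁ → ¬ MultiAgent.IsDCD G p q :=
      fun p q hp hq hpq => hpq.not_isControllable hp hq h
    refine ⟨fun hQ => hQ.not_isControllable h, fun p q r hp hq hr ht => ?_, hD⟩
    rcases ht.exists_isDCD (by simpa using hp) (by simpa using hq) (by simpa using hr)
      with h | h | h
    exacts [hD _ _ hp hq h, hD _ _ hp hr h, hD _ _ hq hr h]
  · rintro ⟨hQ, -, hD⟩
    obtain ⟨f, hf⟩ : ∃ f : Fin 5 ≃ V, f 0 = v₁ := by
      let g : Fin 5 ≃ V := (Fintype.equivFinOfCardEq hV).symm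
      -- Swapping g 0 with v₁ makes 0 the leader's label.
      exact ⟨g.trans (Equiv.swap (g 0) v₁), by simp⟩
    refine MultiAgent.isControllable_of_krylovDet_ne_zero hf fun hdet => ?_
    have htest := MultiAgent.krylovDet_ne_zero_or_destructiveTest
      (MultiAgent.labelledAdj f G 0 1) (MultiAgent.labelledAdj f G 0 2)
      (MultiAgent.labelledAdj f G 0 3) (MultiAgent.labelledAdj f G 0 4)
      (MultiAgent.labelledAdj f G 1 2) (MultiAgent.labelledAdj f G 1 3)
      (MultiAgent.labelledAdj f G 1 4) (MultiAgent.labelledAdj f G 2 3)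
      (MultiAgent.labelledAdj f G 2 4) (MultiAgent.labelledAdj f G 3 4)
    rw [hdet, beq_self_eq_true, Bool.not_true, Bool.or_false] at htest
    exact (MultiAgent.destructive_of_destructiveTest hf hG htest).elim hQ
      fun ⟨p, q, hp, hq, h⟩ => hD p q hp hq h
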